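/- For a finite poset $P$, let $\dim(P)$ be its Dushnik–Miller dimension (the least $d\ge 1$ such that the order of $P$ is the intersection of $d$ linear extensions). Let $S_d$ ($d\ge2$) be the standard example: the poset with minimal elements $a_1,\dots,a_d$, maximal elements $a'_1,\dots,a'_d$, and $a_i<a'_j$ if and only if $i\ne j$. Let $\mathrm{se}(P)$ be the largest $d\ge 2$ such that $P$ contains a subposet isomorphic to $S_d$, with $\mathrm{se}(P)=1$ if there is none. For $n\ge1$ put $q=n^{-1/3}$ and $p=1-q$, and let $P$ be a random bipartite poset: its ground set is the disjoint union of $A$ and $A'$ with $|A|=|A'|=n$, each pair $(a,a')\in A\times A'$ satisfies $a<a'$ with probability $p$, independently of the other pairs, and there are no other strict comparabilities. Then, with probability tending to $1$ as $n\to\infty$, $$\mathrm{se}(P)<4n^{1/3}\log n\qquad\text{and}\qquad \dim(P)\ge n-32\,n^{2/3}\log^{1/2}n .$$ The second bound holds also with $\dim(P)$ replaced by the bipartite dimension of $P$, the least $d\ge1$ for which there are $d$ linear extensions of $P$ such that every incomparable pair $(a,a')\in A\times A'$ has $a>a'$ in at least one of them. For a positive integer $c$ let $\mathrm{sa}(c)$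 be the least positive integer $m$ such that, for every $n>m$, every poset $P$ on $2n+1$ points with $\dim(P)\ge n-c$ satisfies $\mathrm{se}(P)\ge n-m$ (with $\mathrm{sa}(c)=\infty$ if there were no such $m$). Then $$\mathrm{sa}(c)=\Omega\!\left(\frac{c^{3/2}}{\log^{3/4}c}\right),$$ that is, there is a constant $K>0$ with $\mathrm{sa}(c)\ge K\,c^{3/2}/\log^{3/4}c$ for all sufficiently large $c$. In particular, if $\mathrm{sa}(c)=O(c^{\alpha})$ for a real number $\alpha$, then $\alpha\ge 3/2$. -/

import Mathlib

open Filter Topology MeasureTheory ProbabilityTheory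
open scoped ENNReal unitInterval

/-- The linear order `L` is a linear extension of the partial order of `P`. -/
def IsLinearExtension {P : Type*} [PartialOrder P] (L : P → P → Prop) : Prop :=
  IsLinearOrder P L ∧ ∀ x y : P, x ≤ y → L x y

/-- The family `L 0, …, L (d-1)` of linear extensions is a realizer of `P`: the order of `P` is
the intersection of these linear orders. -/
def IsRealizer {P : Type*} [PartialOrder P] {d : ℕ} (L : Fin d → P → P → Prop) : Prop :=
  (∀ j, IsLinearExtension (L j)) ∧ ∀ x y : P, x ≤ y ↔ ∀ j, L j x y

/-- The Dushnik–Miller dimension of a (finite) poset: the least positive size of a realizer. -/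
noncomputable def posetDim (P : Type*) [PartialOrder P] : ℕ :=
  sInf {d : ℕ | 0 < d ∧ ∃ L : Fin d → P → P → Prop, IsRealizer L}

/-- The bipartite poset on the disjoint union of `A` and `A'` in which `a < a'` exactly when
`(a, a') ∈ R`, for `a ∈ A` and `a' ∈ A'`, and there are no other strict comparabilities.
So `A` consists of minimal elements and `A'` of maximal elements. -/
def BipartitePoset {A A' : Type*} (_R : Set (A × A')) : Type _ := A ⊕ A'

namespace BipartitePoset

variable {A A' : Type*} {R : Set (A × A')}

/-- The point of the poset given by an element of the lower side `A`. -/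
def lower (R : Set (A × A')) (a : A) : BipartitePoset R := Sum.inl a

/-- The point of the poset given by an element of the upper side `A'`. -/
def upper (R : Set (A × A')) (a' : A') : BipartitePoset R := Sum.inr a'

instance : PartialOrder (BipartitePoset R) where
  le x y := x = y ∨ ∃ a a', (a, a') ∈ R ∧ x = lower R a ∧ y = upper R a'
  le_refl x := Or.inl rfl
  le_trans x y z := by
    rintro (rfl | ⟨a, a', h, rfl, rfl⟩) (rfl | ⟨b, b', h', hy, rfl⟩)
    · exact Or.inl rfl
    · exact Or.inr ⟨b, b', h', hy, rfl⟩
    · exact Or.inr ⟨a, a', h, rfl, rfl⟩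
    · cases hy
  le_antisymm x y := by
    rintro (rfl | ⟨a, a', h, rfl, rfl⟩) (hy | ⟨b, b', h', hy, hx⟩)
    · rfl
    · rfl
    · exact hy.symm
    · cases hy

/-- The dimension of a bipartite poset in the bipartite sense: the least positive `d` for which
there are linear extensions `L 0, …, L (d-1)` such that for every incomparable pair
`(a, a') ∈ A × A'` some `L j` puts `a` above `a'`. -/
noncomputable def bipDim (R : Set (A × A')) : ℕ :=
  sInf {d : ℕ | 0 < d ∧ ∃ L : Fin d → BipartitePoset R → BipartitePoset R → Prop,
    (∀ j, IsLinearExtension (L j)) ∧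
      ∀ a a', (a, a') ∉ R → ∃ j, L j (upper R a') (lower R a)}

end BipartitePoset

/-- The standard example `S_d`: minimal elements `a_1, …, a_d`, maximal elements
`a'_1, …, a'_d`, and `a_i < a'_j` if and only if `i ≠ j`. -/
abbrev StandardExample (d : ℕ) : Type :=
  BipartitePoset {e : Fin d × Fin d | e.1 ≠ e.2}

/-- `P` contains a subposet isomorphic to the standard example `S_d`. -/
def ContainsStandardExample (P : Type*) [PartialOrder P] (d : ℕ) : Prop :=
  Nonempty (StandardExample d ↪o P)

open Classical in
/-- The standard example number of a (finite) poset: `1` if it does not contain `S_2`, and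
otherwise the largest `d ≥ 2` for which it contains `S_d`. -/
noncomputable def stdExampleNumber (P : Type*) [PartialOrder P] : ℕ :=
  if ContainsStandardExample P 2 then sSup {d : ℕ | 2 ≤ d ∧ ContainsStandardExample P d} else 1

theorem rpow_neg_third_mem_unitInterval (n : ℕ) : (n : ℝ) ^ (-(1 / 3) : ℝ) ∈ I := by
  refine ⟨by positivity, ?_⟩
  rcases Nat.eq_zero_or_pos n with rfl | hn
  · rw [Nat.cast_zero, Real.zero_rpow (by norm_num)]
    exact zero_le_one
  · exact Real.rpow_le_one_of_one_le_of_nonpos (by exact_mod_cast hn) (by norm_num)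

/-- The incomparability probability `q = n^{-1/3}`. -/
noncomputable def qParam (n : ℕ) : I := ⟨(n : ℝ) ^ (-(1 / 3) : ℝ), rpow_neg_third_mem_unitInterval n⟩

/-- The law of a random bipartite poset with `|A| = |A'| = n`, coded by its set
`R ⊆ A × A'` of pairs `a < a'`: every pair belongs to `R` with probability `p`, independently. -/
noncomputable def randomBipartite (n : ℕ) (p : I) : Measure (Set (Fin n × Fin n)) :=
  setBernoulli Set.univ p

/-- The property `E` holds asymptotically almost surely for the random bipartite poset with
`|A| = |A'| = n` in which a pair is comparable with probability `p n`. -/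
def HoldsAAS (p : ℕ → I) (E : ∀ n : ℕ, Set (Fin n × Fin n) → Prop) : Prop :=
  Tendsto (fun n => randomBipartite n (p n) {R | E n R}) atTop (𝓝 1)

/-- `m` is an admissible value at `c` of the function asked for in the stability question:
every poset on `2n+1` points with `n > m` and dimension at least `n - c` has standard example
number at least `n - m`. -/
def IsStabilityBound (c m : ℕ) : Prop :=
  0 < m ∧ ∀ n : ℕ, m < n → ∀ (P : Type) [PartialOrder P], Nat.card P = 2 * n + 1 →
    n ≤ posetDim P + c → n ≤ stdExampleNumber P + m

/-- The stability function: `sa c` is the least admissible value at `c` (`⊤` if there were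
none). -/
noncomputable def sa (c : ℕ) : ℕ∞ := ⨅ m ∈ {m : ℕ | IsStabilityBound c m}, (m : ℕ∞)

/-! Write s = n^{1/3}, so q = 1/s. The bound on `stdExampleNumber` is a first moment computation: a
standard example of size D needs D(D-1) comparable pairs, and p^{D(D-1)} beats the n^{2D} placements
once D ≥ 4 s log n.

For the dimension, suppose d linear extensions reverse every incomparable pair. Choose distinct a_j
∈ A and b_j ∈ A' such that, in L_j, the point a_j lies above every unchosen lower point and b_j
below every unchosen upper point. Let X and Y be the unchosen points, n - d on each side. If L_j
puts y below x, for x ∈ X and y ∈ Y, then (a_j, y) and (x, b_j) are incomparable. If moreover x is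
not among the k highest points of X and y not among the k lowest points of Y, then k+1 points above
x and k+1 points below y form a biclique of incomparable pairs, which is unlikely for k = 6. So the
data a, b, u, v (u and v record these extreme points), together with the rows a_j and columns b_j of
R, determine a set of cells of X × Y that must all be comparable (`exists_forcedPairs_subset`). When
incomparability degrees are at most m, this set has at least (n-d)^2 - 2(n-d)km cells
(`le_card_forcedPairs`). It is independent of R on X × Y, so it is comparable with probability at
most p^t, where t bounds its size from below. A union bound over the n^{14d} choices of data
finishes (`randomBipartite_forcedPairs_le`).

For `sa`, add a top element to such a poset: this gives 2n+1 points, does not lower the dimension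
and keeps the standard example number. Taking n of order c^{3/2}/log^{3/4} c makes the dimension
deficit at most c, while the standard example number is below n/2, so every admissible m is at least
n/2. -/

/-! ### Linear extensions and realizers. -/

section Realizers

/-- Two elements with `¬ x ≤ y` can be put in the opposite order by a linear extension. -/
theorem exists_isLinearExtension_not {P : Type*} [PartialOrder P] {x y : P} (hxy : ¬ x ≤ y) :
    ∃ L : P → P → Prop, IsLinearExtension L ∧ ¬ L x y := by
  -- This is the order of P with the relation y ≤ x added and closed under transitivity.
  let r : P → P → Prop := fun u v => u ≤ v ∨ (u ≤ y ∧ x ≤ v)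
  have hr : IsPartialOrder P r :=
    { refl := fun u => Or.inl le_rfl
      trans := by
        rintro u v w (h | ⟨h, h'⟩) (k | ⟨k, k'⟩)
        · exact Or.inl (h.trans k)
        · exact Or.inr ⟨h.trans k, k'⟩
        · exact Or.inr ⟨h, h'.trans k⟩
        · exact Or.inr ⟨h, k'⟩
      antisymm := by
        rintro u v (h | ⟨h, h'⟩) (k | ⟨k, k'⟩)
        · exact le_antisymm h k
        · exact (hxy (k'.trans (h.trans k))).elim
        · exact (hxy (h'.trans (k.trans h))).elim
        · exact (hxy (k'.trans h)).elim }
  obtain ⟨L, hL, hrL⟩ := extend_partialOrder r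
  refine ⟨L, ⟨hL, fun u v h => hrL _ _ (Or.inl h)⟩, fun h => ?_⟩
  have h' : L y x := hrL _ _ (Or.inr ⟨le_rfl, le_rfl⟩)
  exact hxy (hL.antisymm _ _ h h').le

theorem exists_isRealizer (P : Type*) [PartialOrder P] [Finite P] :
    ∃ d : ℕ, 0 < d ∧ ∃ L : Fin d → P → P → Prop, IsRealizer L := by
  classical
  -- One extension is taken per ordered pair; the extra index `none` makes the family nonempty even
  -- when P is empty.
  have key : ∀ o : Option (P × P), ∃ L : P → P → Prop, IsLinearExtension L ∧
      ∀ x y, o = some (x, y) → ¬ x ≤ y → ¬ L x y := by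
    have triv : ∃ L : P → P → Prop, IsLinearExtension L := by
      obtain ⟨L, hL, h⟩ := extend_partialOrder ((· ≤ ·) : P → P → Prop)
      exact ⟨L, hL, fun x y hxy => h x y hxy⟩
    rintro (_ | ⟨x, y⟩)
    · obtain ⟨L, hL⟩ := triv
      exact ⟨L, hL, by simp⟩
    · by_cases hxy : x ≤ y
      · obtain ⟨L, hL⟩ := triv
        refine ⟨L, hL, ?_⟩
        rintro _ _ ⟨⟩ h
        exact (h hxy).elim
      · obtain ⟨L, hL, h⟩ := exists_isLinearExtension_not hxy
        refine ⟨L, hL, ?_⟩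
        rintro _ _ ⟨⟩ _
        exact h
  choose L hL hL' using key
  obtain ⟨d, ⟨e⟩⟩ := Finite.exists_equiv_fin (Option (P × P))
  refine ⟨d, ?_, fun j => L (e.symm j), fun j => hL _, fun x y => ⟨fun h j => (hL _).2 _ _ h, ?_⟩⟩
  · exact (Nat.zero_le _).trans_lt (e none).2
  · intro h
    by_contra hxy
    exact hL' (some (x, y)) x y rfl hxy (by simpa using h (e (some (x, y))))

theorem posetDim_spec (P : Type*) [PartialOrder P] [Finite P] :
    0 < posetDim P ∧ ∃ L : Fin (posetDim P) → P → P → Prop, IsRealizer L :=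
  Nat.sInf_mem (s := {d : ℕ | 0 < d ∧ ∃ L : Fin d → P → P → Prop, IsRealizer L})
    (exists_isRealizer P)

theorem IsLinearExtension.comap {P Q : Type*} [PartialOrder P] [PartialOrder Q] (f : P ↪o Q)
    {L : Q → Q → Prop} (hL : IsLinearExtension L) :
    IsLinearExtension fun x y => L (f x) (f y) :=
  ⟨{ refl := fun _ => hL.1.refl _
     trans := fun _ _ _ => hL.1.trans _ _ _
     antisymm := fun _ _ h h' => f.injective (hL.1.antisymm _ _ h h')
     total := fun _ _ => hL.1.total _ _ }, fun _ _ h => hL.2 _ _ (f.monotone h)⟩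

theorem posetDim_le_of_orderEmbedding {P Q : Type*} [PartialOrder P] [PartialOrder Q] [Finite Q]
    (f : P ↪o Q) : posetDim P ≤ posetDim Q := by
  obtain ⟨h0, L, hL, h⟩ := posetDim_spec Q
  refine Nat.sInf_le ⟨h0, fun j x y => L j (f x) (f y), fun j => (hL j).comap f, fun x y => ?_⟩
  rw [← h, f.le_iff_le]

end Realizers

/-! ### Order and reversing families in bipartite posets. -/

namespace BipartitePoset

variable {A A' : Type*} {R : Set (A × A')}

instance [Finite A] [Finite A'] : Finite (BipartitePoset R) :=
  inferInstanceAs (Finite (A ⊕ A'))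

theorem lower_ne_upper (a : A) (a' : A') : lower R a ≠ upper R a' := Sum.inl_ne_inr

theorem lower_injective : Function.Injective (lower R) := Sum.inl_injective

theorem upper_injective : Function.Injective (upper R) := Sum.inr_injective

theorem eq_lower_or_eq_upper (x : BipartitePoset R) :
    (∃ a, x = lower R a) ∨ ∃ a', x = upper R a' := by
  rcases x with a | a'
  · exact Or.inl ⟨a, rfl⟩
  · exact Or.inr ⟨a', rfl⟩

theorem lower_le_upper_iff {a : A} {a' : A'} : lower R a ≤ upper R a' ↔ (a, a') ∈ R := by
  constructor
  · rintro (h | ⟨b, b', h, hb, hb'⟩)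
    · exact (lower_ne_upper _ _ h).elim
    · rwa [lower_injective hb, upper_injective hb']
  · exact fun h => Or.inr ⟨a, a', h, rfl, rfl⟩

theorem eq_lower_eq_upper_of_lt {x y : BipartitePoset R} (h : x < y) :
    ∃ a a', (a, a') ∈ R ∧ x = lower R a ∧ y = upper R a' :=
  h.le.resolve_left h.ne

theorem exists_reversing [Finite A] [Finite A'] (R : Set (A × A')) :
    0 < posetDim (BipartitePoset R) ∧
      ∃ L : Fin (posetDim (BipartitePoset R)) → BipartitePoset R → BipartitePoset R → Prop,
      (∀ j, IsLinearExtension (L j)) ∧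
        ∀ a a', (a, a') ∉ R → ∃ j, L j (upper R a') (lower R a) := by
  obtain ⟨h0, L, hL, h⟩ := posetDim_spec (BipartitePoset R)
  refine ⟨h0, L, hL, fun a a' ha => ?_⟩
  rw [← lower_le_upper_iff, h, not_forall] at ha
  obtain ⟨j, hj⟩ := ha
  exact ⟨j, ((hL j).1.total _ _).resolve_left hj⟩

theorem bipDim_le_posetDim [Finite A] [Finite A'] (R : Set (A × A')) :
    bipDim R ≤ posetDim (BipartitePoset R) :=
  Nat.sInf_le (exists_reversing R)

theorem bipDim_spec [Finite A] [Finite A'] (R : Set (A × A')) :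
    0 < bipDim R ∧ ∃ L : Fin (bipDim R) → BipartitePoset R → BipartitePoset R → Prop,
      (∀ j, IsLinearExtension (L j)) ∧
        ∀ a a', (a, a') ∉ R → ∃ j, L j (upper R a') (lower R a) :=
  Nat.sInf_mem (s := {d : ℕ | 0 < d ∧ ∃ L : Fin d → BipartitePoset R → BipartitePoset R → Prop,
    (∀ j, IsLinearExtension (L j)) ∧ ∀ a a', (a, a') ∉ R → ∃ j, L j (upper R a') (lower R a)})
    ⟨_, exists_reversing R⟩

end BipartitePoset

/-! ### Standard examples in bipartite posets and under adding a top. -/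

section StandardExamples

open BipartitePoset

theorem StandardExample.lower_lt_upper {d : ℕ} {i j : Fin d} (h : i ≠ j) :
    (lower _ i : StandardExample d) < upper _ j :=
  lt_of_le_of_ne (lower_le_upper_iff.2 h) (lower_ne_upper _ _)

theorem exists_ne_fin {d : ℕ} (hd : 2 ≤ d) (i : Fin d) : ∃ j, j ≠ i := by
  have : Nontrivial (Fin d) := Fin.nontrivial_iff_two_le.2 hd
  exact exists_ne i

/-- A standard example in a bipartite poset has its minimal elements on the lower side and its
maximal elements on the upper side. -/
theorem ContainsStandardExample.exists_sides {A A' : Type*} {R : Set (A × A')} {d : ℕ}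
    (hd : 2 ≤ d) (h : ContainsStandardExample (BipartitePoset R) d) :
    ∃ (f : Fin d → A) (g : Fin d → A'), f.Injective ∧ g.Injective ∧
      ∀ i j, i ≠ j → (f i, g j) ∈ R := by
  obtain ⟨φ⟩ := h
  -- As d ≥ 2, each minimal element of the standard example has something strictly above it, which
  -- forces its image to the lower side; maximal elements are dual.
  have hf : ∀ i : Fin d, ∃ a, φ (lower _ i) = lower R a := fun i => by
    obtain ⟨j, hj⟩ := exists_ne_fin hd i
    obtain ⟨a, _, _, h, _⟩ :=
      eq_lower_eq_upper_of_lt (φ.strictMono (StandardExample.lower_lt_upper hj.symm))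
    exact ⟨a, h⟩
  have hg : ∀ i : Fin d, ∃ a, φ (upper _ i) = upper R a := fun i => by
    obtain ⟨j, hj⟩ := exists_ne_fin hd i
    obtain ⟨_, a, _, _, h⟩ :=
      eq_lower_eq_upper_of_lt (φ.strictMono (StandardExample.lower_lt_upper hj))
    exact ⟨a, h⟩
  choose f hf using hf
  choose g hg using hg
  refine ⟨f, g, fun i j h => ?_, fun i j h => ?_, fun i j h => ?_⟩
  · exact lower_injective (φ.injective (by rw [hf, hf, h]))
  · exact upper_injective (φ.injective (by rw [hg, hg, h]))
  · have := φ.monotone (StandardExample.lower_lt_upper h).le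
    rwa [hf, hg, lower_le_upper_iff] at this

/-- The top cannot be used: a minimal element of the standard example has something strictly above
it, and each maximal element misses its own partner, whereas ⊤ is above everything. -/
theorem containsStandardExample_withTop_iff {P : Type*} [PartialOrder P] {d : ℕ} (hd : 2 ≤ d) :
    ContainsStandardExample (WithTop P) d ↔ ContainsStandardExample P d := by
  constructor
  · rintro ⟨φ⟩
    have hne : ∀ x, φ x ≠ ⊤ := by
      intro x hx
      rcases eq_lower_or_eq_upper x with ⟨i, rfl⟩ | ⟨i, rfl⟩
      · obtain ⟨j, hj⟩ := exists_ne_fin hd i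
        have := φ.strictMono (StandardExample.lower_lt_upper hj.symm)
        exact not_top_lt (hx ▸ this)
      · have : φ (lower _ i) ≤ φ (upper _ i) := hx ▸ le_top
        rw [φ.le_iff_le, lower_le_upper_iff] at this
        exact this rfl
    refine ⟨OrderEmbedding.ofMapLEIff (fun x => (φ x).untop (hne x)) fun x y => ?_⟩
    rw [← WithTop.coe_le_coe, WithTop.coe_untop, WithTop.coe_untop, φ.le_iff_le]
  · rintro ⟨φ⟩
    exact ⟨φ.trans WithTop.coeOrderHom⟩

theorem stdExampleNumber_withTop (P : Type*) [PartialOrder P] :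
    stdExampleNumber (WithTop P) = stdExampleNumber P := by
  have : {d : ℕ | 2 ≤ d ∧ ContainsStandardExample (WithTop P) d} =
      {d : ℕ | 2 ≤ d ∧ ContainsStandardExample P d} :=
    Set.ext fun d => and_congr_right containsStandardExample_withTop_iff
  rw [stdExampleNumber, stdExampleNumber, this, containsStandardExample_withTop_iff le_rfl]

theorem stdExampleNumber_lt {P : Type*} [PartialOrder P] {D : ℕ} (hD : 2 ≤ D)
    (h : ∀ d, D ≤ d → ¬ ContainsStandardExample P d) : stdExampleNumber P < D := by
  rw [stdExampleNumber]
  split_ifs with h2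
  · have : sSup {d : ℕ | 2 ≤ d ∧ ContainsStandardExample P d} ≤ D - 1 := by
      refine csSup_le ⟨2, le_rfl, h2⟩ fun d hd => ?_
      by_contra hlt
      exact h d (by omega) hd.2
    omega
  · omega

theorem posetDim_le_posetDim_withTop (P : Type*) [PartialOrder P] [Finite P] :
    posetDim P ≤ posetDim (WithTop P) :=
  haveI : Finite (WithTop P) := inferInstanceAs (Finite (Option P))
  posetDim_le_of_orderEmbedding WithTop.coeOrderHom

end StandardExamples

/-! ### Independence for the random set. -/

section RandomSet

variable {ι : Type*} [Fintype ι] {p : I}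

theorem setBernoulli_real_eq_sum (S : Set (Set ι)) [DecidablePred (· ∈ S)] :
    (setBernoulli Set.univ p).real S =
      ∑ R with R ∈ S, (p : ℝ) ^ R.ncard * (1 - p : ℝ) ^ Rᶜ.ncard := by
  have h := sum_measureReal_singleton (μ := setBernoulli (Set.univ : Set ι) p)
    (Finset.univ.filter (· ∈ S))
  rw [show ((Finset.univ.filter (· ∈ S) : Finset (Set ι)) : Set (Set ι)) = S by ext; simp] at h
  rw [← h]
  refine Finset.sum_congr rfl fun R _ => ?_
  rw [setBernoulli_real_singleton p (Set.subset_univ R) Set.finite_univ, Set.compl_eq_univ_sdiff]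

/-- Deleting e is a bijection between the two events and trades one factor p for one factor 1 - p.
The cross-multiplied form also covers p = 1. -/
theorem setBernoulli_real_mem_and_mul {e : ι} {F : Set ι → Prop}
    (hF : ∀ R, F (insert e R) ↔ F R) :
    (setBernoulli Set.univ p).real {R | e ∈ R ∧ F R} * (1 - p : ℝ) =
      p * (setBernoulli Set.univ p).real {R | e ∉ R ∧ F R} := by
  classical
  rw [setBernoulli_real_eq_sum, setBernoulli_real_eq_sum, Finset.sum_mul, Finset.mul_sum]
  have hins : ∀ R : Set ι, e ∈ R → insert e (R \ {e}) = R := fun R h => by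
    rw [Set.insert_sdiff_singleton, Set.insert_eq_of_mem h]
  have hsd : ∀ R : Set ι, e ∉ R → insert e R \ {e} = R := fun R h => by
    ext x
    by_cases hx : x = e <;> simp [hx, h]
  refine Finset.sum_bij' (fun R _ => R \ {e}) (fun R _ => insert e R) ?_ ?_ ?_ ?_ ?_
  · intro R hR
    simp only [Finset.mem_filter, Finset.mem_univ, true_and, Set.mem_ofPred_eq] at hR ⊢
    refine ⟨by simp, ?_⟩
    rw [← hF, hins R hR.1]
    exact hR.2
  · intro R hR
    simp only [Finset.mem_filter, Finset.mem_univ, true_and, Set.mem_ofPred_eq] at hR ⊢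
    exact ⟨by simp, (hF R).2 hR.2⟩
  · intro R hR
    simp only [Finset.mem_filter, Finset.mem_univ, true_and, Set.mem_ofPred_eq] at hR
    exact hins R hR.1
  · intro R hR
    simp only [Finset.mem_filter, Finset.mem_univ, true_and, Set.mem_ofPred_eq] at hR
    exact hsd R hR.1
  · intro R hR
    simp only [Finset.mem_filter, Finset.mem_univ, true_and, Set.mem_ofPred_eq] at hR
    have h1 : R.ncard = (R \ {e}).ncard + 1 := (Set.ncard_sdiff_singleton_add_one hR.1).symm
    have h2 : (R \ {e})ᶜ.ncard = Rᶜ.ncard + 1 := by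
      rw [show (R \ {e})ᶜ = insert e Rᶜ by ext x; simp; tauto, Set.ncard_insert_of_notMem]
      simpa using hR.1
    rw [h1, h2]
    ring

theorem setBernoulli_real_mem_add_notMem (e : ι) (F : Set ι → Prop) :
    (setBernoulli Set.univ p).real {R | e ∈ R ∧ F R} +
      (setBernoulli Set.univ p).real {R | e ∉ R ∧ F R} =
      (setBernoulli Set.univ p).real {R | F R} := by
  have := measureReal_inter_add_sdiff (μ := setBernoulli (Set.univ : Set ι) p) (s := {R | F R})
    (t := {R | e ∈ R}) (Set.toFinite _).measurableSet
  rw [← this]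
  congr 2 <;> ext R <;> simp [and_comm]

theorem setBernoulli_real_mem_and {e : ι} {F : Set ι → Prop} (hF : ∀ R, F (insert e R) ↔ F R) :
    (setBernoulli Set.univ p).real {R | e ∈ R ∧ F R} =
      p * (setBernoulli Set.univ p).real {R | F R} := by
  have h1 := setBernoulli_real_mem_and_mul (p := p) hF
  have h2 := setBernoulli_real_mem_add_notMem (p := p) e F
  rw [← h2]
  linear_combination h1

theorem setBernoulli_real_notMem_and {e : ι} {F : Set ι → Prop}
    (hF : ∀ R, F (insert e R) ↔ F R) :
    (setBernoulli Set.univ p).real {R | e ∉ R ∧ F R} =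
      (1 - p) * (setBernoulli Set.univ p).real {R | F R} := by
  have h1 := setBernoulli_real_mem_and (p := p) hF
  have h2 := setBernoulli_real_mem_add_notMem (p := p) e F
  linear_combination h2 - h1

/-- Containing `T` is independent of every event that does not depend on the points of `T`. -/
theorem setBernoulli_real_subset_and (T : Finset ι) {F : Set ι → Prop}
    (hF : ∀ e ∈ T, ∀ R, F (insert e R) ↔ F R) :
    (setBernoulli Set.univ p).real {R | ↑T ⊆ R ∧ F R} =
      (p : ℝ) ^ T.card * (setBernoulli Set.univ p).real {R | F R} := by
  classical
  induction T using Finset.induction_on with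
  | empty => simp
  | insert a T ha ih =>
    have h1 : {R : Set ι | ↑(insert a T) ⊆ R ∧ F R} = {R | a ∈ R ∧ (↑T ⊆ R ∧ F R)} := by
      ext R
      simp [Set.insert_subset_iff, and_assoc]
    rw [h1, setBernoulli_real_mem_and, ih fun e he => hF e (Finset.mem_insert_of_mem he),
      Finset.card_insert_of_notMem ha]
    · ring
    · intro R
      rw [hF a (Finset.mem_insert_self _ _), Set.subset_insert_iff_of_notMem (by simpa using ha)]

theorem setBernoulli_real_subset (T : Finset ι) :
    (setBernoulli Set.univ p).real {R | (T : Set ι) ⊆ R} = (p : ℝ) ^ T.card := by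
  simpa using setBernoulli_real_subset_and (p := p) T (F := fun _ => True) (by simp)

theorem setBernoulli_real_subset_compl (T : Finset ι) :
    (setBernoulli Set.univ p).real {R | (T : Set ι) ⊆ Rᶜ} = (1 - p : ℝ) ^ T.card := by
  classical
  induction T using Finset.induction_on with
  | empty => simp
  | insert a T ha ih =>
    have h1 : {R : Set ι | (↑(insert a T) : Set ι) ⊆ Rᶜ} =
        {R | a ∉ R ∧ (T : Set ι) ⊆ Rᶜ} := by
      ext R
      simp [Set.insert_subset_iff]
    rw [h1, setBernoulli_real_notMem_and, ih, Finset.card_insert_of_notMem ha]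
    · ring
    · intro R
      simp only [Set.subset_compl_iff_disjoint_right, Set.disjoint_insert_right,
        and_iff_right_iff_imp]
      exact fun _ => by simpa using ha

/-- The random set contains a large subset of `B` that depends only on its trace outside `B` with
small probability. -/
theorem setBernoulli_real_subset_le (B : Set ι) (T : Set ι → Finset ι) (hTB : ∀ R, ↑(T R) ⊆ B)
    (hT : ∀ e ∈ B, ∀ R, T (insert e R) = T R) (t : ℕ) :
    (setBernoulli Set.univ p).real {R | ↑(T R) ⊆ R ∧ t ≤ (T R).card} ≤ (p : ℝ) ^ t := by
  classical
  set μ := setBernoulli (Set.univ : Set ι) p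
  -- Split by the value U of T R: for fixed U ⊆ B the event T R = U ignores the points of U, so
  -- containing U costs an independent factor p^|U|. These events are disjoint in U, so their
  -- probabilities sum to 1.
  have hsub : {R | ↑(T R) ⊆ R ∧ t ≤ (T R).card} ⊆
      ⋃ U ∈ (Finset.univ.filter fun U : Finset ι => t ≤ U.card ∧ ↑U ⊆ B),
        {R | ↑U ⊆ R ∧ T R = U} := by
    intro R hR
    simp only [Set.mem_iUnion, Finset.mem_filter, Finset.mem_univ, true_and]
    exact ⟨T R, ⟨hR.2, hTB R⟩, hR.1, rfl⟩
  calc μ.real {R | ↑(T R) ⊆ R ∧ t ≤ (T R).card}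
      ≤ ∑ U with t ≤ U.card ∧ ↑U ⊆ B, μ.real {R | ↑U ⊆ R ∧ T R = U} :=
        (measureReal_mono hsub (measure_ne_top _ _)).trans (measureReal_biUnion_finset_le _ _)
    _ ≤ ∑ U with t ≤ U.card ∧ ↑U ⊆ B, (p : ℝ) ^ t * μ.real {R | T R = U} := by
        refine Finset.sum_le_sum fun U hU => ?_
        simp only [Finset.mem_filter, Finset.mem_univ, true_and] at hU
        rw [setBernoulli_real_subset_and U fun e he R => by rw [hT e (hU.2 he)]]
        exact mul_le_mul_of_nonneg_right
          (pow_le_pow_of_le_one p.2.1 p.2.2 hU.1) measureReal_nonneg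
    _ ≤ (p : ℝ) ^ t * ∑ U, μ.real {R | T R = U} := by
        rw [Finset.mul_sum]
        exact Finset.sum_le_sum_of_subset_of_nonneg (Finset.subset_univ _) fun _ _ _ =>
          mul_nonneg (pow_nonneg p.2.1 _) measureReal_nonneg
    _ = (p : ℝ) ^ t := by
        rw [← measureReal_biUnion_finset, show (⋃ U ∈ Finset.univ, {R | T R = U}) = Set.univ by
          ext; simp]
        · simp
        · intro U _ V _ hUV
          exact Set.disjoint_left.2 fun R h h' => hUV (h.symm.trans h')
        · exact fun _ _ => (Set.toFinite _).measurableSet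

end RandomSet

/-! ### Top elements of total preorders. -/

section TotalPreorders

variable {A : Type*}

theorem Finset.exists_forall_rel {r : A → A → Prop} (total : ∀ x y, r x y ∨ r y x)
    (trans : ∀ x y z, r x y → r y z → r x z) {s : Finset A} (hs : s.Nonempty) :
    ∃ m ∈ s, ∀ x ∈ s, r x m := by
  classical
  induction hs using Finset.Nonempty.cons_induction with
  | singleton a => exact ⟨a, by simp, by simpa using total a a⟩
  | cons a s ha hs ih =>
    obtain ⟨m, hm, h⟩ := ih
    rcases total a m with h' | h'
    · exact ⟨m, by simp [hm], by simpa [h'] using h⟩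
    · refine ⟨a, by simp, fun x hx => ?_⟩
      rcases Finset.mem_cons.1 hx with rfl | hx
      · simpa using total x x
      · exact trans _ _ _ (h x hx) h'

/-- Finitely many total preorders have distinct representatives such that each of them dominates,
in its preorder, everything that is not a representative. -/
theorem exists_injective_dominating [Fintype A] {d : ℕ} (hd : d ≤ Fintype.card A)
    {r : Fin d → A → A → Prop} (total : ∀ j x y, r j x y ∨ r j y x)
    (trans : ∀ j x y z, r j x y → r j y z → r j x z) :
    ∃ a : Fin d → A, a.Injective ∧ ∀ j, ∀ x ∉ Set.range a, r j x (a j) := by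
  classical
  induction d with
  | zero => exact ⟨Fin.elim0, fun j => j.elim0, fun j => j.elim0⟩
  | succ d ih =>
    obtain ⟨a, ha, h⟩ := ih (by omega) (r := fun j => r j.castSucc) (fun j => total _)
      (fun j => trans _)
    have hne : (Finset.univ \ Finset.univ.image a : Finset A).Nonempty := by
      rw [← Finset.card_pos, Finset.card_sdiff_of_subset (Finset.subset_univ _),
        Finset.card_image_of_injective _ ha, Finset.card_univ, Finset.card_univ, Fintype.card_fin]
      omega
    -- Greedy choice: the last preorder takes its maximum among the elements not yet used.
    obtain ⟨m, hm, hmax⟩ := Finset.exists_forall_rel (total (Fin.last d)) (trans (Fin.last d)) hne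
    have hm' : m ∉ Set.range a := by simpa using hm
    refine ⟨Fin.snoc (α := fun _ => A) a m, Fin.snoc_injective_iff.2 ⟨ha, hm'⟩, fun j x hx => ?_⟩
    rw [Fin.range_snoc, Set.mem_insert_iff, not_or] at hx
    induction j using Fin.lastCases with
    | last => simpa using hmax x (by simpa using hx.2)
    | cast j => simpa using h j x hx.2

/-- Apart from at most `k` elements, every element of `X` is dominated by `k` further ones. -/
theorem exists_fin_tops [Nonempty A] {r : A → A → Prop} (total : ∀ x y, r x y ∨ r y x)
    (trans : ∀ x y z, r x y → r y z → r x z) (X : Finset A) (k : ℕ) :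
    ∃ u : Fin k → A, ∀ x ∈ X, (∃ i, x = u i) ∨
      ∃ S ⊆ X, S.card = k + 1 ∧ ∀ z ∈ S, r x z := by
  classical
  -- U consists of the elements with at most k elements of X above them, themselves included. All of
  -- U lies above its lowest element, so U has at most k elements.
  set U := X.filter fun x => (X.filter (r x)).card ≤ k with hU
  have hcard : U.card ≤ k := by
    rcases U.eq_empty_or_nonempty with h | h
    · simp [h]
    · obtain ⟨m, hm, hmin⟩ := Finset.exists_forall_rel (r := fun x y => r y x)
        (fun x y => total y x) (fun x y z h h' => trans _ _ _ h' h) h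
      refine (Finset.card_le_card fun x hx => ?_).trans (Finset.mem_filter.1 hm).2
      exact Finset.mem_filter.2 ⟨(Finset.mem_filter.1 hx).1, hmin x hx⟩
  obtain ⟨e⟩ : Nonempty (U ↪ Fin k) :=
    Function.Embedding.nonempty_of_card_le (by simpa using hcard)
  -- Slots of u not needed for U hold an arbitrary element.
  refine ⟨Function.extend e Subtype.val fun _ => Classical.arbitrary A, fun x hx => ?_⟩
  by_cases hxU : x ∈ U
  · exact Or.inl ⟨e ⟨x, hxU⟩, by rw [e.injective.extend_apply]⟩
  · have : k + 1 ≤ (X.filter (r x)).card := by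
      by_contra h
      exact hxU (Finset.mem_filter.2 ⟨hx, by omega⟩)
    obtain ⟨S, hS, hSc⟩ := Finset.exists_subset_card_eq this
    exact Or.inr ⟨S, hS.trans (Finset.filter_subset _ _), hSc,
      fun z hz => (Finset.mem_filter.1 (hS hz)).2⟩

end TotalPreorders

/-! ### Forced pairs. -/

/-- For fixed y, injectivity of a leaves at most m indices j with (a_j, y) ∉ R, and each contributes
at most k values of x. -/
theorem card_exists_le {A A' : Type*} [Fintype A] {d k : ℕ} [DecidableEq A] [DecidableEq A'] {R : Set (A × A')}
    [DecidablePred (· ∈ R)] {a : Fin d → A} (ha : a.Injective)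
    (u : Fin d → Fin k → A) {m : ℕ}
    (hm : ∀ y, (Finset.univ.filter fun x => (x, y) ∉ R).card ≤ m) (Y : Finset A') :
    ((Finset.univ ×ˢ Y).filter fun e => ∃ j i, e.1 = u j i ∧ (a j, e.2) ∉ R).card ≤
      Y.card * (k * m) := by
  have hsub : ((Finset.univ ×ˢ Y).filter fun e => ∃ j i, e.1 = u j i ∧ (a j, e.2) ∉ R) ⊆
      Y.biUnion fun y => (Finset.univ ×ˢ Finset.univ.filter fun j => (a j, y) ∉ R).image
        fun p : Fin k × Fin d => (u p.2 p.1, y) := by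
    rintro ⟨x, y⟩ he
    simp only [Finset.mem_filter, Finset.mem_product, Finset.mem_univ, true_and] at he
    obtain ⟨hy, j, i, rfl, hj⟩ := he
    exact Finset.mem_biUnion.2 ⟨y, hy, Finset.mem_image.2 ⟨(i, j), by simpa using hj, rfl⟩⟩
  refine (Finset.card_le_card hsub).trans (Finset.card_biUnion_le_card_mul _ _ _ fun y _ => ?_)
  refine Finset.card_image_le.trans ?_
  rw [Finset.card_product, Finset.card_univ, Fintype.card_fin]
  refine Nat.mul_le_mul_left _ (le_trans ?_ (hm y))
  rw [← Finset.card_image_of_injective _ ha]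
  exact Finset.card_le_card fun x hx => by
    obtain ⟨j, hj, rfl⟩ := Finset.mem_image.1 hx
    simpa using hj

section ForcedPairs

open BipartitePoset

variable {A A' : Type*} [Fintype A] [Fintype A'] {d k : ℕ}

open Classical in
/-- The pairs outside the ranges of `a` and `b` that can be incomparable for no reversing family
whose top elements are recorded by `a`, `b`, `u`, `v`. -/
noncomputable def forcedPairs (a : Fin d → A) (b : Fin d → A') (u : Fin d → Fin k → A)
    (v : Fin d → Fin k → A') (R : Set (A × A')) : Finset (A × A') :=
  ((Finset.univ.filter (· ∉ Set.range a)) ×ˢ (Finset.univ.filter (· ∉ Set.range b))).filter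
    fun e => ¬ ((∃ j i, e.1 = u j i ∧ (a j, e.2) ∉ R) ∨ ∃ j i, e.2 = v j i ∧ (e.1, b j) ∉ R)

theorem forcedPairs_subset (a : Fin d → A) (b : Fin d → A') (u : Fin d → Fin k → A)
    (v : Fin d → Fin k → A') (R : Set (A × A')) :
    (forcedPairs a b u v R : Set (A × A')) ⊆ (Set.range a)ᶜ ×ˢ (Set.range b)ᶜ := by
  intro e he
  simp only [forcedPairs, Finset.coe_filter, Finset.mem_product, Finset.mem_filter,
    Finset.mem_univ, true_and, Set.mem_ofPred_eq] at he
  exact ⟨he.1.1, he.1.2⟩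

/-- The definition consults R only in rows a_j and columns b_j. This is the independence from the
complementary block that `setBernoulli_real_subset_le` needs. -/
theorem forcedPairs_insert {a : Fin d → A} {b : Fin d → A'} (u : Fin d → Fin k → A)
    (v : Fin d → Fin k → A') {e : A × A'} (he : e ∈ (Set.range a)ᶜ ×ˢ (Set.range b)ᶜ)
    (R : Set (A × A')) : forcedPairs a b u v (insert e R) = forcedPairs a b u v R := by
  have h1 : ∀ j y, (a j, y) ∈ insert e R ↔ (a j, y) ∈ R := fun j y =>
    Set.mem_insert_iff.trans (or_iff_right fun h => he.1 ⟨j, congrArg Prod.fst h⟩)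
  have h2 : ∀ j x, (x, b j) ∈ insert e R ↔ (x, b j) ∈ R := fun j x =>
    Set.mem_insert_iff.trans (or_iff_right fun h => he.2 ⟨j, congrArg Prod.snd h⟩)
  ext f
  simp only [forcedPairs, Finset.mem_filter, h1, h2]

theorem card_notMem_range {n : ℕ} {a : Fin d → A} (ha : a.Injective) (hn : Fintype.card A = n)
    [DecidablePred (· ∉ Set.range a)] :
    (Finset.univ.filter (· ∉ Set.range a)).card = n - d := by
  classical
  rw [show Finset.univ.filter (· ∉ Set.range a) = Finset.univ \ Finset.univ.image a by ext; simp,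
    Finset.card_sdiff_of_subset (Finset.subset_univ _),
    Finset.card_image_of_injective _ ha, Finset.card_univ, Finset.card_univ, Fintype.card_fin, hn]

/-- The cells that are not forced are of two kinds, exchanged by transposing R; `card_exists_le`
bounds each. -/
theorem le_card_forcedPairs {n m : ℕ} (hA : Fintype.card A = n) (hA' : Fintype.card A' = n)
    [DecidableEq A] [DecidableEq A'] {R : Set (A × A')} [DecidablePred (· ∈ R)]
    (hm : ∀ y, (Finset.univ.filter fun x => (x, y) ∉ R).card ≤ m)
    (hm' : ∀ x, (Finset.univ.filter fun y => (x, y) ∉ R).card ≤ m)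
    {a : Fin d → A} {b : Fin d → A'} (ha : a.Injective) (hb : b.Injective)
    (u : Fin d → Fin k → A) (v : Fin d → Fin k → A') :
    (n - d) * (n - d) ≤ (forcedPairs a b u v R).card + 2 * ((n - d) * (k * m)) := by
  classical
  set X := Finset.univ.filter (· ∉ Set.range a) with hX
  set Y := Finset.univ.filter (· ∉ Set.range b) with hY
  have hXc : X.card = n - d := by rw [hX, card_notMem_range ha hA]
  have hYc : Y.card = n - d := by rw [hY, card_notMem_range hb hA']
  have h1 := card_exists_le ha u hm Y
  have h2 := card_exists_le (R := Prod.swap ⁻¹' R) hb v (fun x => by convert hm' x; exact Iff.rfl) X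
  have h3 := Finset.card_filter_add_card_filter_not (s := X ×ˢ Y)
    fun e => (∃ j i, e.1 = u j i ∧ (a j, e.2) ∉ R) ∨ ∃ j i, e.2 = v j i ∧ (e.1, b j) ∉ R
  have h4 : ((X ×ˢ Y).filter fun e => (∃ j i, e.1 = u j i ∧ (a j, e.2) ∉ R) ∨
      ∃ j i, e.2 = v j i ∧ (e.1, b j) ∉ R).card ≤
      ((Finset.univ ×ˢ Y).filter fun e => ∃ j i, e.1 = u j i ∧ (a j, e.2) ∉ R).card +
      ((Finset.univ ×ˢ X).filter fun e => ∃ j i, e.1 = v j i ∧ (b j, e.2) ∉ Prod.swap ⁻¹' R).card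
      := by
    rw [Finset.filter_or]
    refine (Finset.card_union_le _ _).trans (add_le_add (Finset.card_le_card ?_) ?_)
    · exact Finset.filter_subset_filter _
        (Finset.product_subset_product_left (Finset.subset_univ _))
    · refine Finset.card_le_card_of_injOn Prod.swap (fun e he => ?_) Prod.swap_injective.injOn
      simp only [Finset.coe_filter, Finset.mem_product, Set.mem_ofPred_eq, Finset.mem_univ,
        true_and, Prod.fst_swap, Prod.snd_swap, Set.mem_preimage, Prod.swap_prod_mk] at he ⊢
      exact ⟨he.1.1, he.2⟩
  have h5 : forcedPairs a b u v R = (X ×ˢ Y).filter fun e =>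
      ¬ ((∃ j i, e.1 = u j i ∧ (a j, e.2) ∉ R) ∨ ∃ j i, e.2 = v j i ∧ (e.1, b j) ∉ R) := by
    ext e
    simp [forcedPairs, hX, hY]
  rw [Finset.card_product, hXc, hYc, ← h5] at h3
  rw [hXc] at h2
  rw [hYc] at h1
  omega

/-- A reversing family of linear extensions makes all its forced pairs comparable, provided that
the incomparability graph contains no complete bipartite graph `K_{k+1,k+1}`. -/
theorem exists_forcedPairs_subset [Nonempty A] [Nonempty A'] {R : Set (A × A')}
    (hd : d ≤ Fintype.card A) (hd' : d ≤ Fintype.card A')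
    (hK : ∀ (S : Finset A) (S' : Finset A'), S.card = k + 1 → S'.card = k + 1 →
      ¬ ((S ×ˢ S' : Finset (A × A')) : Set (A × A')) ⊆ Rᶜ)
    {L : Fin d → BipartitePoset R → BipartitePoset R → Prop} (hL : ∀ j, IsLinearExtension (L j))
    (hrev : ∀ a a', (a, a') ∉ R → ∃ j, L j (upper R a') (lower R a)) :
    ∃ (a : Fin d → A) (b : Fin d → A') (u : Fin d → Fin k → A) (v : Fin d → Fin k → A'),
      a.Injective ∧ b.Injective ∧ (forcedPairs a b u v R : Set (A × A')) ⊆ R := by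
  classical
  have htot := fun j => (hL j).1.total
  have htr := fun j => (hL j).1.trans
  have hnot : ∀ j x y, L j (upper R y) (lower R x) → (x, y) ∉ R := fun j x y h hR =>
    lower_ne_upper x y ((hL j).1.antisymm _ _ ((hL j).2 _ _ (lower_le_upper_iff.2 hR)) h)
  obtain ⟨a, ha, hamax⟩ := exists_injective_dominating hd
    (r := fun j x y => L j (lower R x) (lower R y)) (fun j _ _ => htot j _ _)
    (fun j _ _ _ => htr j _ _ _)
  -- The order is reversed on the upper side, so b_j is extreme from below.
  obtain ⟨b, hb, hbmax⟩ := exists_injective_dominating hd'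
    (r := fun j x y => L j (upper R y) (upper R x)) (fun j _ _ => htot j _ _)
    (fun j _ _ _ h h' => htr j _ _ _ h' h)
  have hu := fun j => exists_fin_tops (r := fun x y => L j (lower R x) (lower R y))
    (fun _ _ => htot j _ _) (fun _ _ _ => htr j _ _ _)
    (Finset.univ.filter (· ∉ Set.range a)) k
  have hv := fun j => exists_fin_tops (r := fun x y => L j (upper R y) (upper R x))
    (fun _ _ => htot j _ _) (fun _ _ _ h h' => htr j _ _ _ h' h)
    (Finset.univ.filter (· ∉ Set.range b)) k
  choose u hu using hu
  choose v hv using hv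
  refine ⟨a, b, u, v, ha, hb, fun e he => ?_⟩
  have hXY := forcedPairs_subset _ _ _ _ _ he
  simp only [forcedPairs, Finset.coe_filter, Finset.mem_product, Set.mem_ofPred_eq] at he
  obtain ⟨⟨hx, hy⟩, hcell⟩ := he
  rw [not_or] at hcell
  by_contra hR
  obtain ⟨j, hj⟩ := hrev e.1 e.2 hR
  -- If x were a recorded top of L_j, then y below x below a_j would make (a_j, y) incomparable, and
  -- the cell would not be forced.
  obtain ⟨S, -, hSc, hS⟩ := (hu j e.1 hx).resolve_left fun ⟨i, hi⟩ =>
    hcell.1 ⟨j, i, hi, hnot j _ _ (htr j _ _ _ hj (hamax j _ hXY.1))⟩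
  obtain ⟨S', -, hSc', hS'⟩ := (hv j e.2 hy).resolve_left fun ⟨i, hi⟩ =>
    hcell.2 ⟨j, i, hi, hnot j _ _ (htr j _ _ _ (hbmax j _ hXY.2) hj)⟩
  -- In L_j all of S' lies below y, then x, then all of S, so S × S' is a forbidden biclique.
  refine hK S S' hSc hSc' fun f hf => ?_
  rw [Finset.coe_product] at hf
  exact hnot j _ _ (htr j _ _ _ (hS' _ hf.2) (htr j _ _ _ hj (hS _ hf.1)))

end ForcedPairs

/-! ### First moment bounds. -/

section UnionBounds

theorem measureReal_exists_le {Ω α : Type*} [MeasurableSpace Ω] (μ : Measure Ω)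
    [IsFiniteMeasure μ] (s : Finset α) (E : α → Ω → Prop) {c : ℝ}
    (h : ∀ i ∈ s, μ.real {ω | E i ω} ≤ c) :
    μ.real {ω | ∃ i ∈ s, E i ω} ≤ s.card * c := by
  have h1 : {ω | ∃ i ∈ s, E i ω} = ⋃ i ∈ s, {ω | E i ω} := by
    ext
    simp
  rw [h1]
  refine (measureReal_biUnion_finset_le _ _).trans ((Finset.sum_le_sum h).trans ?_)
  rw [Finset.sum_const, nsmul_eq_mul]

variable {n : ℕ} (p : I)

instance : IsProbabilityMeasure (randomBipartite n p) :=
  inferInstanceAs (IsProbabilityMeasure (setBernoulli _ p))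

/-- The expected number of pairs `S × S'` of prescribed sizes without comparable pairs. -/
theorem randomBipartite_product_subset_compl_le (s s' : ℕ) :
    (randomBipartite n p).real {R | ∃ S S' : Finset (Fin n), S.card = s ∧ S'.card = s' ∧
      ((S ×ˢ S' : Finset (Fin n × Fin n)) : Set (Fin n × Fin n)) ⊆ Rᶜ} ≤
      (n.choose s * n.choose s' : ℕ) * (1 - p : ℝ) ^ (s * s') := by
  have h := measureReal_exists_le (randomBipartite n p)
    (Finset.powersetCard s Finset.univ ×ˢ Finset.powersetCard s' Finset.univ)
    (fun e R => ((e.1 ×ˢ e.2 : Finset (Fin n × Fin n)) : Set (Fin n × Fin n)) ⊆ Rᶜ)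
    (c := (1 - p : ℝ) ^ (s * s')) (fun e he => by
      simp only [Finset.mem_product, Finset.mem_powersetCard, Finset.subset_univ, true_and] at he
      rw [randomBipartite, setBernoulli_real_subset_compl, Finset.card_product, he.1, he.2])
  rw [Finset.card_product, Finset.card_powersetCard, Finset.card_powersetCard, Finset.card_univ,
    Fintype.card_fin] at h
  refine le_trans (measureReal_mono ?_ (measure_ne_top _ _)) h
  rintro R ⟨S, S', hS, hS', hR⟩
  exact ⟨(S, S'), by simp [hS, hS'], hR⟩

/-- The expected number of standard examples of size `d`. -/
theorem randomBipartite_standardExample_le (d : ℕ) :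
    (randomBipartite n p).real {R | ∃ f g : Fin d → Fin n, f.Injective ∧ g.Injective ∧
      ∀ i j, i ≠ j → (f i, g j) ∈ R} ≤ (n ^ d * n ^ d : ℕ) * (p : ℝ) ^ (d * (d - 1)) := by
  classical
  have h := measureReal_exists_le (randomBipartite n p)
    (Finset.univ.filter fun e : (Fin d → Fin n) × (Fin d → Fin n) =>
      e.1.Injective ∧ e.2.Injective)
    (fun e R => ∀ i j, i ≠ j → (e.1 i, e.2 j) ∈ R) (c := (p : ℝ) ^ (d * (d - 1)))
    (fun e he => by
      simp only [Finset.mem_filter, Finset.mem_univ, true_and] at he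
      have hc : ((Finset.univ : Finset (Fin d)).offDiag.image (Prod.map e.1 e.2)).card =
          d * (d - 1) := by
        rw [Finset.card_image_of_injective _ (he.1.prodMap he.2), Finset.offDiag_card,
          Finset.card_univ, Fintype.card_fin, Nat.mul_sub_one]
      rw [← hc, randomBipartite, ← setBernoulli_real_subset]
      refine le_of_eq (congrArg _ (Set.ext fun R => ?_))
      simp [Set.subset_def]
      grind)
  refine (measureReal_mono ?_ (measure_ne_top _ _)).trans (h.trans ?_)
  · rintro R ⟨f, g, hf, hg, hR⟩
    exact ⟨(f, g), by simp [hf, hg], hR⟩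
  · refine mul_le_mul_of_nonneg_right (Nat.cast_le.2 ((Finset.card_filter_le _ _).trans ?_))
      (pow_nonneg p.2.1 _)
    simp

/-- It is unlikely that a large set of forced pairs is comparable. -/
theorem randomBipartite_forcedPairs_le (d k t : ℕ) :
    (randomBipartite n p).real {R | ∃ (a b : Fin d → Fin n) (u v : Fin d → Fin k → Fin n),
      (forcedPairs a b u v R : Set (Fin n × Fin n)) ⊆ R ∧ t ≤ (forcedPairs a b u v R).card} ≤
      ((n ^ d * n ^ d) * ((n ^ k) ^ d * (n ^ k) ^ d) : ℕ) * (p : ℝ) ^ t := by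
  classical
  have h := measureReal_exists_le (randomBipartite n p)
    (Finset.univ : Finset (((Fin d → Fin n) × (Fin d → Fin n)) ×
      ((Fin d → Fin k → Fin n) × (Fin d → Fin k → Fin n))))
    (fun e R => (forcedPairs e.1.1 e.1.2 e.2.1 e.2.2 R : Set (Fin n × Fin n)) ⊆ R ∧
      t ≤ (forcedPairs e.1.1 e.1.2 e.2.1 e.2.2 R).card) (c := (p : ℝ) ^ t)
    (fun e _ => setBernoulli_real_subset_le ((Set.range e.1.1)ᶜ ×ˢ (Set.range e.1.2)ᶜ) _
      (fun R => forcedPairs_subset _ _ _ _ R) (fun f hf R => forcedPairs_insert _ _ hf R) t)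
  refine (measureReal_mono ?_ (measure_ne_top _ _)).trans (h.trans (le_of_eq ?_))
  · rintro R ⟨a, b, u, v, hR⟩
    exact ⟨((a, b), (u, v)), Finset.mem_univ _, hR⟩
  · simp

end UnionBounds

/-! ### Deterministic consequences of avoiding the bad events. -/

section Bounds

open BipartitePoset

/-- The incomparability graph of the bipartite poset contains a complete bipartite graph with
sides of sizes `s` and `s'`. -/
def HasBiclique {n : ℕ} (R : Set (Fin n × Fin n)) (s s' : ℕ) : Prop :=
  ∃ S S' : Finset (Fin n), S.card = s ∧ S'.card = s' ∧
    ((S ×ˢ S' : Finset (Fin n × Fin n)) : Set (Fin n × Fin n)) ⊆ Rᶜ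

/-- For some `d < n`, a set of at least `t` forced pairs is comparable. -/
def HasComparableForcedPairs {n : ℕ} (R : Set (Fin n × Fin n)) (k t : ℕ) : Prop :=
  ∃ d ∈ Finset.range n, ∃ (a b : Fin d → Fin n) (u v : Fin d → Fin k → Fin n),
    (forcedPairs a b u v R : Set (Fin n × Fin n)) ⊆ R ∧ t ≤ (forcedPairs a b u v R).card

/-- The hypothesis `hnum` is applied to e = n - d with d the bipartite dimension; it says that the
e² cells, less the unforced ones, still number at least t. -/
theorem sub_le_bipDim {n k m t : ℕ} {δ : ℝ} (hn : 0 < n) (hδ : 0 ≤ δ)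
    (hnum : ∀ e : ℕ, δ < e → t + 2 * (e * (k * m)) ≤ e * e) {R : Set (Fin n × Fin n)}
    (hK : ¬ HasBiclique R (k + 1) (k + 1)) (hcol : ¬ HasBiclique R m 1)
    (hrow : ¬ HasBiclique R 1 m) (hF : ¬ HasComparableForcedPairs R k t) :
    (n : ℝ) - δ ≤ bipDim R := by
  classical
  by_contra! hlt
  obtain ⟨-, L, hL, hrev⟩ := bipDim_spec R
  have hdn : bipDim R < n := by
    have : (bipDim R : ℝ) < n := by linarith
    exact_mod_cast this
  have : Nonempty (Fin n) := ⟨⟨0, hn⟩⟩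
  obtain ⟨a, b, u, v, ha, hb, hsub⟩ := exists_forcedPairs_subset (k := k) (by simpa using hdn.le)
    (by simpa using hdn.le) (fun S S' hS hS' h => hK ⟨S, S', hS, hS', h⟩) hL hrev
  have hm : ∀ y, (Finset.univ.filter fun x => (x, y) ∉ R).card ≤ m := fun y => by
    by_contra! h
    obtain ⟨S, hS, hSc⟩ := Finset.exists_subset_card_eq h.le
    refine hcol ⟨S, {y}, hSc, Finset.card_singleton _, fun e he => ?_⟩
    simp only [Finset.coe_product, Finset.coe_singleton, Set.mem_prod, Finset.mem_coe,
      Set.mem_singleton_iff] at he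
    have := hS he.1
    rw [Finset.mem_filter, ← he.2] at this
    exact this.2
  have hm' : ∀ x, (Finset.univ.filter fun y => (x, y) ∉ R).card ≤ m := fun x => by
    by_contra! h
    obtain ⟨S, hS, hSc⟩ := Finset.exists_subset_card_eq h.le
    refine hrow ⟨{x}, S, Finset.card_singleton _, hSc, fun e he => ?_⟩
    simp only [Finset.coe_product, Finset.coe_singleton, Set.mem_prod, Finset.mem_coe,
      Set.mem_singleton_iff] at he
    have := hS he.2
    rw [Finset.mem_filter, ← he.1] at this
    exact this.2
  have hcard := le_card_forcedPairs (Fintype.card_fin n) (Fintype.card_fin n) hm hm' ha hb u v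
  have he := hnum (n - bipDim R) (by rw [Nat.cast_sub hdn.le]; linarith)
  exact hF ⟨_, Finset.mem_range.2 hdn, a, b, u, v, hsub, by omega⟩

/-- Larger standard examples restrict to size D, so only that size has to be excluded. -/
theorem stdExampleNumber_bipartitePoset_lt {n D : ℕ} (hD : 2 ≤ D) {R : Set (Fin n × Fin n)}
    (h : ¬ ∃ f g : Fin D → Fin n, f.Injective ∧ g.Injective ∧ ∀ i j, i ≠ j → (f i, g j) ∈ R) :
    stdExampleNumber (BipartitePoset R) < D := by
  refine stdExampleNumber_lt hD fun d hd hc => h ?_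
  obtain ⟨f, g, hf, hg, hR⟩ := hc.exists_sides (hD.trans hd)
  have hi := Fin.castLE_injective hd
  exact ⟨f ∘ Fin.castLE hd, g ∘ Fin.castLE hd, hf.comp hi, hg.comp hi,
    fun i j hij => hR _ _ (hi.ne hij)⟩

end Bounds

/-! ### Numerical estimates, with s = n^{1/3} and l = log n. -/

section Numerics

open Real

variable {n : ℕ} {s l : ℝ}

theorem numeric_standardExample (hs : 1 ≤ s) (hl : 2 ≤ l) (hn : (n : ℝ) = exp l) {p : ℝ}
    (hp0 : 0 ≤ p) (hp : p ≤ exp (-s⁻¹)) {D : ℕ} (hD : 4 * s * l ≤ D) :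
    ((n ^ D * n ^ D : ℕ) : ℝ) * p ^ (D * (D - 1)) ≤ exp (-l) := by
  have hs0 : 0 < s := by linarith
  have hD1 : (1 : ℝ) ≤ D := by nlinarith
  have hD1' : 1 ≤ D := by exact_mod_cast hD1
  have h1 : p ^ (D * (D - 1)) ≤ exp (-(D * (D - 1) * s⁻¹)) := by
    refine (pow_le_pow_left₀ hp0 hp _).trans (le_of_eq ?_)
    rw [← exp_nat_mul, Nat.cast_mul, Nat.cast_sub hD1', Nat.cast_one]
    ring_nf
  have h2 : ((n ^ D * n ^ D : ℕ) : ℝ) = exp (2 * D * l) := by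
    push_cast
    rw [hn, ← exp_nat_mul, ← exp_add]
    ring_nf
  rw [h2]
  refine (mul_le_mul_of_nonneg_left h1 (exp_pos _).le).trans ?_
  rw [← exp_add, exp_le_exp]
  have h3 : 4 * l ≤ D * s⁻¹ := by
    rw [← div_eq_mul_inv, le_div_iff₀ hs0]
    linarith
  have h4 : s⁻¹ ≤ 1 := inv_le_one_of_one_le₀ hs
  nlinarith [mul_le_mul_of_nonneg_left h3 (by linarith : (0 : ℝ) ≤ D),
    mul_le_mul_of_nonneg_left h4 (by linarith : (0 : ℝ) ≤ D)]

/-- The bound is n^{14 - 49/3} = n^{-7/3}; 7 is the least side length for which this estimate tends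
to 0, hence k = 6. -/
theorem numeric_biclique (hs : 1 ≤ s) (hsn : s ^ 3 = n) :
    ((n.choose 7 * n.choose 7 : ℕ) : ℝ) * s⁻¹ ^ (7 * 7) ≤ (n : ℝ)⁻¹ := by
  have hs0 : 0 < s := by linarith
  have h1 : (n.choose 7 : ℝ) ≤ s ^ 21 := by
    have := Nat.choose_le_pow n 7
    calc (n.choose 7 : ℝ) ≤ (n : ℝ) ^ 7 := by exact_mod_cast this
      _ = s ^ 21 := by rw [← hsn]; ring
  push_cast
  calc (n.choose 7 : ℝ) * n.choose 7 * s⁻¹ ^ (7 * 7) ≤ s ^ 21 * s ^ 21 * s⁻¹ ^ (7 * 7) := by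
        gcongr
    _ = (s * s⁻¹) ^ 42 * s⁻¹ ^ 7 := by ring
    _ = s⁻¹ ^ 7 := by rw [mul_inv_cancel₀ hs0.ne', one_pow, one_mul]
    _ ≤ s⁻¹ ^ 3 := pow_le_pow_of_le_one (by positivity) (inv_le_one_of_one_le₀ hs) (by norm_num)
    _ = (n : ℝ)⁻¹ := by rw [← hsn, inv_pow]

/-- The mean degree is nq = s². At m ≥ 8s² the bound (nq)^m / m! is at most (e/8)^m, which is at
most e^{-m} as e² < 8, and m ≥ 2l. -/
theorem numeric_degree (hs : 1 ≤ s) (hsn : s ^ 3 = n) (hn : (n : ℝ) = exp l) (hl : l ≤ 4 * s)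
    {m : ℕ} (hm : 8 * s ^ 2 ≤ m) :
    (n : ℝ) * n.choose m * s⁻¹ ^ m ≤ exp (-l) := by
  have hs0 : 0 < s := by linarith
  have hfac : (0 : ℝ) < m.factorial := by exact_mod_cast m.factorial_pos
  have h1 : (n.choose m : ℝ) * s⁻¹ ^ m ≤ exp (-m) := by
    calc (n.choose m : ℝ) * s⁻¹ ^ m ≤ (n : ℝ) ^ m / m.factorial * s⁻¹ ^ m := by
          gcongr
          exact Nat.choose_le_pow_div m n
      _ = (s ^ 2) ^ m / m.factorial := by
          rw [← hsn, div_mul_eq_mul_div, ← mul_pow]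
          congr 2
          field_simp
      _ ≤ (m / 8) ^ m / m.factorial := by
          gcongr
          linarith
      _ = (m : ℝ) ^ m / m.factorial / 8 ^ m := by rw [div_pow]; ring
      _ ≤ exp m / 8 ^ m := by
          gcongr
          exact pow_div_factorial_le_exp (m : ℝ) (Nat.cast_nonneg m) m
      _ ≤ exp m / exp 2 ^ m := by
          gcongr
          have h := exp_one_lt_d9
          have : exp 2 = exp 1 * exp 1 := by rw [← exp_add]; norm_num
          rw [this]
          nlinarith [exp_pos 1]
      _ = exp (-m) := by
          rw [← exp_nat_mul, ← exp_sub]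
          ring_nf
  calc (n : ℝ) * n.choose m * s⁻¹ ^ m = n * (n.choose m * s⁻¹ ^ m) := by ring
    _ ≤ exp l * exp (-m) := by
        rw [hn]
        gcongr
    _ ≤ exp (-l) := by
        rw [← exp_add, exp_le_exp]
        nlinarith

/-- The exponent is at most 14dl - 512nl, because t/s ≥ 512 s³ l = 512nl. -/
theorem numeric_forcedPairs (hs : 1 ≤ s) (hsn : s ^ 3 = n) (hn : (n : ℝ) = exp l) (hl : 1 ≤ l)
    {p : ℝ} (hp0 : 0 ≤ p) (hp : p ≤ exp (-s⁻¹)) {d t : ℕ} (hd : d < n)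
    (ht : 512 * s ^ 4 * l ≤ t) :
    (((n ^ d * n ^ d) * ((n ^ 6) ^ d * (n ^ 6) ^ d) : ℕ) : ℝ) * p ^ t ≤ exp (-(2 * l)) := by
  have hs0 : 0 < s := by linarith
  have hd' : (d : ℝ) ≤ n := by exact_mod_cast hd.le
  have hn1 : (1 : ℝ) ≤ n := by rw [← hsn]; exact one_le_pow₀ hs
  have h1 : (((n ^ d * n ^ d) * ((n ^ 6) ^ d * (n ^ 6) ^ d) : ℕ) : ℝ) = exp (14 * d * l) := by
    have : (n ^ d * n ^ d) * ((n ^ 6) ^ d * (n ^ 6) ^ d) = n ^ (14 * d) := by ring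
    rw [this, Nat.cast_pow, hn, ← exp_nat_mul]
    push_cast
    rfl
  have h2 : p ^ t ≤ exp (-(512 * n * l)) := by
    refine (pow_le_pow_left₀ hp0 hp _).trans ?_
    rw [← exp_nat_mul, exp_le_exp, ← hsn, mul_neg, neg_le_neg_iff, ← div_eq_mul_inv,
      le_div_iff₀ hs0]
    nlinarith
  rw [h1]
  refine (mul_le_mul_of_nonneg_left h2 (exp_pos _).le).trans ?_
  rw [← exp_add, exp_le_exp]
  nlinarith [mul_le_mul_of_nonneg_right hd' (by linarith : 0 ≤ l),
    mul_le_mul_of_nonneg_right hn1 (by linarith : 0 ≤ l)]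

/-- Here e² exceeds 1024 s⁴ r²: half of e² pays for t. Since r ≥ 10 gives e ≥ 320 s², the term 12em
≤ 108 s² e takes less than the other half. -/
theorem numeric_card (hs : 1 ≤ s) {r : ℝ} (hr : 10 ≤ r) {e : ℝ} (he : 32 * s ^ 2 * r < e)
    {m t : ℝ} (hm : m ≤ 8 * s ^ 2 + 1) (ht : t ≤ 512 * s ^ 4 * r ^ 2 + 1) :
    t + 2 * (e * (6 * m)) ≤ e * e := by
  have hs2 : 1 ≤ s ^ 2 := one_le_pow₀ hs
  have h1 : m ≤ 9 * s ^ 2 := by linarith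
  have h2 : 320 * s ^ 2 ≤ e := by nlinarith
  have he0 : 0 < e := by linarith
  have h3 : e * m ≤ e * (9 * s ^ 2) := mul_le_mul_of_nonneg_left h1 he0.le
  have h4 : e * (320 * s ^ 2) ≤ e * e := mul_le_mul_of_nonneg_left h2 he0.le
  have h5 : (32 * s ^ 2 * r) * (32 * s ^ 2 * r) ≤ e * e :=
    mul_self_le_mul_self (by positivity) he.le
  have h6 : 320 * 1 ≤ e * s ^ 2 := by nlinarith
  nlinarith

end Numerics

/-! ### The random poset satisfies the bounds. -/

section AsymptoticBounds

open BipartitePoset Real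

/-- The bounds on the standard example number and the dimensions of a random bipartite poset. -/
def SatisfiesBounds (n : ℕ) (R : Set (Fin n × Fin n)) : Prop :=
  (stdExampleNumber (BipartitePoset R) : ℝ) < 4 * (n : ℝ) ^ (1 / 3 : ℝ) * Real.log n ∧
    (n : ℝ) - 32 * (n : ℝ) ^ (2 / 3 : ℝ) * (Real.log n) ^ (1 / 2 : ℝ)
      ≤ (posetDim (BipartitePoset R) : ℝ) ∧
    (n : ℝ) - 32 * (n : ℝ) ^ (2 / 3 : ℝ) * (Real.log n) ^ (1 / 2 : ℝ)
      ≤ (BipartitePoset.bipDim R : ℝ)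

theorem randomBipartite_not_satisfiesBounds_le {n : ℕ} (hlog : 100 ≤ Real.log n) :
    (randomBipartite n (unitInterval.symm (qParam n))).real {R | ¬ SatisfiesBounds n R} ≤
      5 * (n : ℝ)⁻¹ := by
  have hn0 : 0 < n := Nat.pos_of_ne_zero fun h => by norm_num [h] at hlog
  have hnR : (0 : ℝ) < n := by exact_mod_cast hn0
  have hn1 : (1 : ℝ) ≤ n := by exact_mod_cast hn0
  set l := Real.log n with hl
  set s : ℝ := (n : ℝ) ^ (1 / 3 : ℝ) with hs
  set r : ℝ := l ^ (1 / 2 : ℝ) with hr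
  set p := unitInterval.symm (qParam n) with hp
  have hs1 : 1 ≤ s := Real.one_le_rpow hn1 (by norm_num)
  have hs0 : 0 < s := by linarith
  have hsn : s ^ 3 = n := by
    rw [hs, ← Real.rpow_natCast, ← Real.rpow_mul hnR.le]
    norm_num
  have hs2 : (n : ℝ) ^ (2 / 3 : ℝ) = s ^ 2 := by
    rw [hs, ← Real.rpow_natCast, ← Real.rpow_mul hnR.le]
    norm_num
  have hnl : (n : ℝ) = exp l := (Real.exp_log hnR).symm
  have hninv : (n : ℝ)⁻¹ = exp (-l) := by rw [hnl, exp_neg]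
  have hls : l ≤ 4 * s := by
    have h1 : l = 3 * Real.log s := by rw [hl, ← hsn, Real.log_pow]; norm_num
    have h2 := Real.log_le_sub_one_of_pos hs0
    linarith
  have hr2 : r ^ 2 = l := by
    rw [hr, ← Real.rpow_natCast, ← Real.rpow_mul (by linarith)]
    norm_num
  have hr0 : 0 ≤ r := Real.rpow_nonneg (by linarith) _
  have hr10 : 10 ≤ r := by nlinarith
  have hq : (1 - p : ℝ) = s⁻¹ := by
    rw [hp, unitInterval.coe_symm_eq, sub_sub_cancel, hs, ← Real.rpow_neg hnR.le]
    rfl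
  have hpe : (p : ℝ) ≤ exp (-s⁻¹) := by
    have := Real.add_one_le_exp (-s⁻¹)
    linarith
  have hp0 : (0 : ℝ) ≤ p := p.2.1
  set D := ⌈4 * s * l⌉₊ with hD
  set m := ⌈8 * s ^ 2⌉₊ with hm
  set t := ⌈512 * s ^ 4 * l⌉₊ with ht
  set μ := randomBipartite n p
  have hD' : 4 * s * l ≤ D := Nat.le_ceil _
  have hD2 : 2 ≤ D := by
    have : (2 : ℝ) ≤ D := by nlinarith
    exact_mod_cast this
  have hm' : 8 * s ^ 2 ≤ m := Nat.le_ceil _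
  have ht' : 512 * s ^ 4 * l ≤ t := Nat.le_ceil _
  have hm1 : (m : ℝ) ≤ 8 * s ^ 2 + 1 := (Nat.ceil_lt_add_one (by positivity)).le
  have ht1 : (t : ℝ) ≤ 512 * s ^ 4 * l + 1 :=
    (Nat.ceil_lt_add_one (mul_nonneg (by positivity) (by linarith))).le
  -- Five bad events, each of probability at most 1/n: a large standard example, a 7 × 7 biclique, a
  -- high degree on either side, and a large comparable forced set.
  set B₁ : Set (Set (Fin n × Fin n)) := {R | ∃ f g : Fin D → Fin n, f.Injective ∧ g.Injective ∧
    ∀ i j, i ≠ j → (f i, g j) ∈ R}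
  set B₂ : Set (Set (Fin n × Fin n)) := {R | HasBiclique R 7 7}
  set B₃ : Set (Set (Fin n × Fin n)) := {R | HasBiclique R m 1}
  set B₄ : Set (Set (Fin n × Fin n)) := {R | HasBiclique R 1 m}
  set B₅ : Set (Set (Fin n × Fin n)) := {R | HasComparableForcedPairs R 6 t}
  have h₁ : μ.real B₁ ≤ (n : ℝ)⁻¹ := by
    rw [hninv]
    exact (randomBipartite_standardExample_le p D).trans
      (numeric_standardExample hs1 (by linarith) hnl hp0 hpe hD')
  have h₂ : μ.real B₂ ≤ (n : ℝ)⁻¹ := by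
    have := randomBipartite_product_subset_compl_le (n := n) p 7 7
    rw [hq] at this
    exact this.trans (numeric_biclique hs1 hsn)
  have h₃ : μ.real B₃ ≤ (n : ℝ)⁻¹ := by
    have := randomBipartite_product_subset_compl_le (n := n) p m 1
    rw [hq, Nat.choose_one_right, mul_one, mul_comm (n.choose m), Nat.cast_mul] at this
    rw [hninv]
    exact this.trans (numeric_degree hs1 hsn hnl hls hm')
  have h₄ : μ.real B₄ ≤ (n : ℝ)⁻¹ := by
    have := randomBipartite_product_subset_compl_le (n := n) p 1 m
    rw [hq, Nat.choose_one_right, one_mul, Nat.cast_mul] at this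
    rw [hninv]
    exact this.trans (numeric_degree hs1 hsn hnl hls hm')
  have h₅ : μ.real B₅ ≤ (n : ℝ)⁻¹ := by
    have := measureReal_exists_le μ (Finset.range n) (fun d R =>
      ∃ (a b : Fin d → Fin n) (u v : Fin d → Fin 6 → Fin n),
        (forcedPairs a b u v R : Set (Fin n × Fin n)) ⊆ R ∧ t ≤ (forcedPairs a b u v R).card)
      (c := exp (-(2 * l))) fun d hd => (randomBipartite_forcedPairs_le p d 6 t).trans
        (numeric_forcedPairs hs1 hsn hnl (by linarith) hp0 hpe (Finset.mem_range.1 hd) ht')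
    refine this.trans (le_of_eq ?_)
    rw [Finset.card_range, hninv]
    nth_rewrite 1 [hnl]
    rw [← exp_add]
    ring_nf
  have hsub : {R | ¬ SatisfiesBounds n R} ⊆ B₁ ∪ (B₂ ∪ (B₃ ∪ (B₄ ∪ B₅))) := by
    intro R hR
    by_contra hB
    simp only [Set.mem_union, not_or] at hB
    obtain ⟨hb₁, hb₂, hb₃, hb₄, hb₅⟩ := hB
    refine hR ?_
    have hbip : (n : ℝ) - 32 * s ^ 2 * r ≤ bipDim R := by
      refine sub_le_bipDim (k := 6) (m := m) (t := t) hn0 (by positivity) (fun e he => ?_)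
        hb₂ hb₃ hb₄ hb₅
      have := numeric_card hs1 hr10 he hm1 (hr2 ▸ ht1)
      exact_mod_cast this
    rw [SatisfiesBounds, hs2]
    refine ⟨?_, hbip.trans (by exact_mod_cast bipDim_le_posetDim R), hbip⟩
    have := stdExampleNumber_bipartitePoset_lt hD2 hb₁
    exact Nat.lt_ceil.1 this
  have hu : ∀ S T : Set (Set (Fin n × Fin n)), μ.real (S ∪ T) ≤ μ.real S + μ.real T :=
    fun S T => measureReal_union_le S T
  have hmono := measureReal_mono (μ := μ) hsub (measure_ne_top _ _)
  linarith [hu B₁ (B₂ ∪ (B₃ ∪ (B₄ ∪ B₅))), hu B₂ (B₃ ∪ (B₄ ∪ B₅)), hu B₃ (B₄ ∪ B₅), hu B₄ B₅]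

theorem tendsto_log_natCast_atTop : Tendsto (fun n : ℕ => Real.log n) atTop atTop :=
  Real.tendsto_log_atTop.comp tendsto_natCast_atTop_atTop

theorem holdsAAS_satisfiesBounds :
    HoldsAAS (fun n => unitInterval.symm (qParam n)) SatisfiesBounds := by
  have hle : ∀ᶠ n : ℕ in atTop, ENNReal.ofReal (1 - 5 * (n : ℝ)⁻¹) ≤
      randomBipartite n (unitInterval.symm (qParam n)) {R | SatisfiesBounds n R} := by
    filter_upwards [tendsto_log_natCast_atTop.eventually_ge_atTop 100] with n hn
    have h := randomBipartite_not_satisfiesBounds_le hn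
    have h' := measureReal_union_le (μ := randomBipartite n (unitInterval.symm (qParam n)))
      {R | SatisfiesBounds n R} {R | ¬ SatisfiesBounds n R}
    rw [show {R | SatisfiesBounds n R} ∪ {R | ¬ SatisfiesBounds n R} = Set.univ by
      ext; simp [em], probReal_univ] at h'
    refine ENNReal.ofReal_le_of_le_toReal ?_
    change _ ≤ Measure.real _ _
    linarith
  have hlim : Tendsto (fun n : ℕ => ENNReal.ofReal (1 - 5 * (n : ℝ)⁻¹)) atTop (𝓝 1) := by
    have : Tendsto (fun n : ℕ => 1 - 5 * (n : ℝ)⁻¹) atTop (𝓝 (1 - 5 * 0)) :=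
      (tendsto_inv_atTop_nhds_zero_nat.const_mul 5).const_sub 1
    simpa using ENNReal.tendsto_ofReal this
  exact tendsto_of_tendsto_of_tendsto_of_le_of_le' hlim tendsto_const_nhds hle
    (Eventually.of_forall fun n => prob_le_one)

theorem exists_satisfiesBounds {n : ℕ} (hlog : 100 ≤ Real.log n) :
    ∃ R : Set (Fin n × Fin n), SatisfiesBounds n R := by
  by_contra! h
  have h1 := randomBipartite_not_satisfiesBounds_le hlog
  rw [show {R | ¬ SatisfiesBounds n R} = Set.univ by ext; simp [h], probReal_univ] at h1
  have hn : (0 : ℝ) < n := by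
    rcases Nat.eq_zero_or_pos n with rfl | hn
    · norm_num at hlog
    · exact_mod_cast hn
  have := (Real.log_le_sub_one_of_pos hn).trans' hlog
  rw [← div_eq_mul_inv, le_div_iff₀ hn] at h1
  linarith

end AsymptoticBounds

/-! ### The stability function. -/

section StabilityFunction

open BipartitePoset Real

/-- The witness is a random bipartite poset with a top added; its standard example number is below 4
n^{1/3} log n ≤ n/2. -/
theorem IsStabilityBound.half_le {c m n : ℕ} (hm : IsStabilityBound c m)
    (hlog : 100 ≤ Real.log n)
    (hc : 32 * (n : ℝ) ^ (2 / 3 : ℝ) * (Real.log n) ^ (1 / 2 : ℝ) ≤ c) : (n : ℝ) / 2 ≤ m := by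
  rcases le_or_gt n m with hnm | hmn
  · have : (n : ℝ) ≤ m := by exact_mod_cast hnm
    linarith [(Nat.cast_nonneg n : (0 : ℝ) ≤ n)]
  have hn0 : (0 : ℝ) < n := by exact_mod_cast (Nat.zero_le m).trans_lt hmn
  obtain ⟨R, hse, hdim, -⟩ := exists_satisfiesBounds hlog
  have hcard : Nat.card (WithTop (BipartitePoset R)) = 2 * n + 1 := by
    change Nat.card (Option (Fin n ⊕ Fin n)) = _
    rw [Nat.card_eq_fintype_card]
    simp
    omega
  have hdim' : n ≤ posetDim (WithTop (BipartitePoset R)) + c := by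
    have h1 : (posetDim (BipartitePoset R) : ℝ) ≤ posetDim (WithTop (BipartitePoset R)) := by
      exact_mod_cast posetDim_le_posetDim_withTop _
    have : (n : ℝ) ≤ posetDim (WithTop (BipartitePoset R)) + c := by linarith
    exact_mod_cast this
  have h := hm.2 n hmn _ hcard hdim'
  rw [stdExampleNumber_withTop] at h
  have h' : (n : ℝ) ≤ stdExampleNumber (BipartitePoset R) + m := by exact_mod_cast h
  set s : ℝ := (n : ℝ) ^ (1 / 3 : ℝ) with hs
  have hs0 : 0 < s := Real.rpow_pos_of_pos hn0 _
  have hsn : s ^ 3 = n := by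
    rw [hs, ← Real.rpow_natCast, ← Real.rpow_mul hn0.le]
    norm_num
  have h1 : Real.log n = 3 * Real.log s := by rw [← hsn, Real.log_pow]; norm_num
  have h2 := Real.log_le_sub_one_of_pos hs0
  have h3 : 24 ≤ s := by linarith
  have h4 : s * Real.log n ≤ s * (3 * s) := mul_le_mul_of_nonneg_left (by linarith) hs0.le
  have h5 : s * s * 24 ≤ s * s * s := mul_le_mul_of_nonneg_left h3 (by positivity)
  nlinarith

theorem eventually_rpow_div_log_ge : ∀ᶠ c : ℕ in atTop,
    (c : ℝ) ≤ (c : ℝ) ^ (3 / 2 : ℝ) / (Real.log c) ^ (3 / 4 : ℝ) := by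
  have h := ((isLittleO_log_rpow_rpow_atTop (3 / 4) (by norm_num : (0 : ℝ) < 1 / 2)).comp_tendsto
    tendsto_natCast_atTop_atTop).bound (zero_lt_one)
  filter_upwards [h, tendsto_log_natCast_atTop.eventually_ge_atTop 1, eventually_gt_atTop 0]
    with c hc hl h0
  have hc0 : (0 : ℝ) < c := by exact_mod_cast h0
  have hlp : 0 < (Real.log c) ^ (3 / 4 : ℝ) := Real.rpow_pos_of_pos (by linarith) _
  simp only [Function.comp_apply, one_mul, Real.norm_eq_abs] at hc
  rw [abs_of_pos hlp, abs_of_pos (Real.rpow_pos_of_pos hc0 _)] at hc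
  rw [le_div_iff₀ hlp, show (3 / 2 : ℝ) = 1 + 1 / 2 by norm_num, Real.rpow_add hc0, Real.rpow_one]
  gcongr

theorem sa_lower_bound : ∀ᶠ c : ℕ in atTop,
    ENNReal.ofReal (1 / 4000 * ((c : ℝ) ^ (3 / 2 : ℝ) / (Real.log c) ^ (3 / 4 : ℝ)))
      ≤ ((sa c : ℕ∞) : ℝ≥0∞) := by
  have hlim : Tendsto (fun c : ℕ => ⌊(c : ℝ) ^ (3 / 2 : ℝ) / (Real.log c) ^ (3 / 4 : ℝ) / 1000⌋₊)
      atTop atTop := tendsto_nat_floor_atTop.comp <|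
    (tendsto_atTop_mono' _ eventually_rpow_div_log_ge tendsto_natCast_atTop_atTop).atTop_div_const
      (by norm_num)
  filter_upwards [(tendsto_log_natCast_atTop.comp hlim).eventually_ge_atTop 100,
    tendsto_log_natCast_atTop.eventually_ge_atTop 1, eventually_rpow_div_log_ge,
    eventually_ge_atTop 2000] with c hlogn hlogc hz hc
  set l := Real.log c with hl
  set z := (c : ℝ) ^ (3 / 2 : ℝ) / l ^ (3 / 4 : ℝ) with hzdef
  simp only [Function.comp_apply] at hlogn
  -- As 1000^{2/3} = 100 and log n ≤ 4 log c, the dimension deficit is at most 32 · 2/100 · c ≤ c.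
  set n := ⌊z / 1000⌋₊ with hn
  have hcR : (2000 : ℝ) ≤ c := by exact_mod_cast hc
  have hc0 : (0 : ℝ) < c := by linarith
  have hl0 : 0 < l := by linarith
  have hz0 : 0 < z := by linarith
  have hnz : (n : ℝ) ≤ z / 1000 := Nat.floor_le (by positivity)
  have hzn : z / 1000 < n + 1 := Nat.lt_floor_add_one _
  have hn0 : (0 : ℝ) < n := by linarith
  have hz23 : z ^ (2 / 3 : ℝ) = c / l ^ (1 / 2 : ℝ) := by
    rw [hzdef, Real.div_rpow (by positivity) (by positivity), ← Real.rpow_mul hc0.le,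
      ← Real.rpow_mul hl0.le]
    norm_num
  have hn23 : (n : ℝ) ^ (2 / 3 : ℝ) ≤ c / l ^ (1 / 2 : ℝ) / 100 := by
    refine (Real.rpow_le_rpow hn0.le hnz (by norm_num)).trans (le_of_eq ?_)
    rw [Real.div_rpow hz0.le (by norm_num), hz23]
    congr 1
    rw [show (1000 : ℝ) = 10 ^ (3 : ℝ) by norm_num, ← Real.rpow_mul (by norm_num)]
    norm_num
  have hlogn' : Real.log n ≤ 4 * l := by
    have h1 : (n : ℝ) ≤ (c : ℝ) ^ (3 / 2 : ℝ) := by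
      have h2 : z ≤ (c : ℝ) ^ (3 / 2 : ℝ) :=
        div_le_self (by positivity) (Real.one_le_rpow hlogc (by norm_num))
      linarith
    have h3 := Real.log_le_log hn0 h1
    rw [Real.log_rpow hc0] at h3
    linarith
  have hlog12 : (Real.log n) ^ (1 / 2 : ℝ) ≤ 2 * l ^ (1 / 2 : ℝ) := by
    refine (Real.rpow_le_rpow (by linarith) hlogn' (by norm_num)).trans (le_of_eq ?_)
    rw [Real.mul_rpow (by norm_num) hl0.le, show (4 : ℝ) = 2 ^ (2 : ℝ) by norm_num,
      ← Real.rpow_mul (by norm_num)]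
    norm_num
  have hbound : 32 * (n : ℝ) ^ (2 / 3 : ℝ) * (Real.log n) ^ (1 / 2 : ℝ) ≤ c := by
    have hlp : 0 < l ^ (1 / 2 : ℝ) := Real.rpow_pos_of_pos hl0 _
    calc 32 * (n : ℝ) ^ (2 / 3 : ℝ) * (Real.log n) ^ (1 / 2 : ℝ)
        ≤ 32 * (c / l ^ (1 / 2 : ℝ) / 100) * (2 * l ^ (1 / 2 : ℝ)) := by gcongr
      _ = 64 / 100 * c := by field_simp; ring
      _ ≤ c := by linarith
  -- As n ≥ 1, 2n ≥ n + 1 > z/1000, so n/2 ≥ z/4000.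
  have hmain : ∀ m, IsStabilityBound c m → 1 / 4000 * z ≤ m := fun m hm => by
    have h1 := hm.half_le hlogn hbound
    have h2 : (1 : ℝ) ≤ n := by exact_mod_cast hn0
    linarith
  have hsa : (⌈1 / 4000 * z⌉₊ : ℕ∞) ≤ sa c :=
    le_iInf₂ fun m hm => by exact_mod_cast Nat.ceil_le.2 (hmain m hm)
  calc ENNReal.ofReal (1 / 4000 * z) ≤ ((⌈1 / 4000 * z⌉₊ : ℕ) : ℝ≥0∞) := by
        rw [← ENNReal.ofReal_natCast]
        exact ENNReal.ofReal_le_ofReal (Nat.le_ceil _)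
    _ ≤ ((sa c : ℕ∞) : ℝ≥0∞) := by
        rw [← ENat.toENNReal_coe]
        exact ENat.toENNReal_le.2 hsa

theorem three_halves_le_of_eventually_le {K C α : ℝ} (hK : 0 < K)
    (h : ∀ᶠ c : ℕ in atTop, K * ((c : ℝ) ^ (3 / 2 : ℝ) / (Real.log c) ^ (3 / 4 : ℝ)) ≤
      C * (c : ℝ) ^ α) : 3 / 2 ≤ α := by
  by_contra! hα
  -- If α < 3/2, the hypothesis gives K c^{3/2-α} ≤ C log^{3/4} c, while this ε makes the right side
  -- at most half the left; |C| + 1 allows for any sign of C.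
  have hε : 0 < K / (2 * (|C| + 1)) := by positivity
  have ho := ((isLittleO_log_rpow_rpow_atTop (3 / 4) (sub_pos.2 hα)).comp_tendsto
    tendsto_natCast_atTop_atTop).bound hε
  obtain ⟨c, hc, ho, hl, h0⟩ := (h.and (ho.and
    ((tendsto_log_natCast_atTop.eventually_ge_atTop 1).and (eventually_gt_atTop 0)))).exists
  have hc0 : (0 : ℝ) < c := by exact_mod_cast h0
  have hlp : 0 < (Real.log c) ^ (3 / 4 : ℝ) := Real.rpow_pos_of_pos (by linarith) _
  have hcα : 0 < (c : ℝ) ^ α := Real.rpow_pos_of_pos hc0 _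
  have hβ : 0 < (c : ℝ) ^ (3 / 2 - α) := Real.rpow_pos_of_pos hc0 _
  simp only [Function.comp_apply, Real.norm_eq_abs] at ho
  rw [abs_of_pos hlp, abs_of_pos hβ, div_mul_eq_mul_div, le_div_iff₀ (by positivity)] at ho
  rw [show (3 / 2 : ℝ) = (3 / 2 - α) + α by ring, Real.rpow_add hc0, ← mul_div_assoc,
    div_le_iff₀ hlp, ← mul_assoc, mul_right_comm C] at hc
  have hc' := le_of_mul_le_mul_right hc hcα
  have h1 : C * (Real.log c) ^ (3 / 4 : ℝ) ≤ (|C| + 1) * (Real.log c) ^ (3 / 4 : ℝ) :=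
    mul_le_mul_of_nonneg_right (by linarith [le_abs_self C]) hlp.le
  nlinarith [mul_pos hK hβ]

end StabilityFunction

theorem mainTheorem4 :
    -- a.a.s. bounds for the random bipartite poset with `p = 1 - q`, `q = n^{-1/3}`
    HoldsAAS (fun n => unitInterval.symm (qParam n)) (fun n R =>
      (stdExampleNumber (BipartitePoset R) : ℝ) < 4 * (n : ℝ) ^ (1 / 3 : ℝ) * Real.log n ∧
      (n : ℝ) - 32 * (n : ℝ) ^ (2 / 3 : ℝ) * (Real.log n) ^ (1 / 2 : ℝ)
        ≤ (posetDim (BipartitePoset R) : ℝ) ∧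
      (n : ℝ) - 32 * (n : ℝ) ^ (2 / 3 : ℝ) * (Real.log n) ^ (1 / 2 : ℝ)
        ≤ (BipartitePoset.bipDim R : ℝ)) ∧
    -- `sa(c) = Ω(c^{3/2} / log^{3/4} c)`
    (∃ K : ℝ, 0 < K ∧ ∀ᶠ c : ℕ in atTop,
      ENNReal.ofReal (K * ((c : ℝ) ^ (3 / 2 : ℝ) / (Real.log c) ^ (3 / 4 : ℝ)))
        ≤ ((sa c : ℕ∞) : ℝ≥0∞)) ∧
    -- hence no exponent below `3/2` is possible in an upper bound for `sa`
    (∀ α : ℝ, (∃ C : ℝ, ∀ᶠ c : ℕ in atTop,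
      ((sa c : ℕ∞) : ℝ≥0∞) ≤ ENNReal.ofReal (C * (c : ℝ) ^ α)) → 3 / 2 ≤ α) := by
  have hK : (0 : ℝ) < 1 / 4000 := by norm_num
  refine ⟨holdsAAS_satisfiesBounds, ⟨1 / 4000, hK, sa_lower_bound⟩, ?_⟩
  rintro α ⟨C, hC⟩
  refine three_halves_le_of_eventually_le (C := C) hK ?_
  filter_upwards [hC, sa_lower_bound, eventually_rpow_div_log_ge, eventually_gt_atTop 0]
    with c hc hc' hz h0
  have hc0 : (0 : ℝ) < c := by exact_mod_cast h0
  have h1 := hc'.trans hc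
  -- The alternative, that the lower bound is nonpositive and truncated to 0, is excluded by its
  -- positivity.
  rw [ENNReal.ofReal_le_ofReal_iff'] at h1
  exact h1.resolve_right (not_le.2 (mul_pos hK (hc0.trans_le hz)))
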